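/- Let $R$ be a (not necessarily commutative) ring with $1\neq 0$, equipped with the discrete norm $|x|=1$ for $x\ne 0$ and $|0|=0$, and let $n\ge 1$. Let $G$ and $H$ be quasi-isometric groups of type $\mathrm{FP}_n(R)$. Then the weighted discrete filling functions of $G$ and $H$ in degree $n$ take finite values and are equivalent. Here the following conventions are used. A group $\Gamma$ is of type $\mathrm{FP}_n(R)$ if the trivial left $R\Gamma$-module $R$ has a projective resolution $P_*\to R$ with $P_i$ finitely generated for all $i\le n$; for $n\geq 1$ such a group is finitely generated. Fix finite generating sets of $G$ and $H$; for $\Gamma\in\{G,H\}$ let $\ell_\Gamma$ be the word length, and $d_\Gamma(x,y)=\ell_\Gamma(x^{-1}y)$ the word metric. The groups are quasi-isometric if there are $K\ge 1$ and $f\colon G\to H$ with $K^{-1}d_G(x,y)-K\le d_H(f(x),f(y))\le K d_G(x,y)+K$ for all $x,y\in G$ and such that every $z\in H$ satisfies $d_H(f(x),z)\le K$ for some $x\in G$. On a free $R\Gamma$-module with finite basis $B$ put $$\Bigl\|\sum_{\gamma\in \Gamma,\,b\in B} a_{\gamma b}\,\gamma b\Bigr\|^{\Gamma}=\sum_{\gamma,b}|a_{\gamma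 b}|\,(1+\ell_\Gamma(\gamma)).$$ Let $P_*\to R$ be any projective $R\Gamma$-resolution of the trivial module $R$ in which $P_{n-1}$ and $P_n$ are finitely generated free and equipped with finite bases. The weighted discrete filling function of $\Gamma$ in degree $n$, computed from $P_*$, is $$F_\Gamma\colon\mathbb R_{\ge 0}\to\mathbb R_{\ge 0}\cup\{\infty\},\qquad F_\Gamma(l)=\sup_{\substack{c\in P_{n-1},\ \partial c=0\\ \|c\|^{\Gamma}\le l}}\ \ \inf_{\substack{b\in P_n\\ \partial b=c}}\|b\|^{\Gamma},$$ where for $n=1$ the condition $\partial c=0$ means that the augmentation $P_0\to R$ maps $c$ to $0$. For $f,g\colon\mathbb R_{\ge 0}\to\mathbb R_{\ge 0}\cup\{\infty\}$ write $f\preccurlyeq g$ if there are constants $C,D>0$ with $f(v)\le C\,g(Cv+D)+Cv+D$ for all $v\ge 0$; $f$ and $g$ are equivalent if $f\preccurlyeq g$ and $g\preccurlyeq f$. The assertion is that for all choices of finite generating sets of $G$ and $H$, and of such resolutions and bases for $G$ and for $H$, the functions $F_G$ and $F_H$ take only finite values and are equivalent. -/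

import Mathlib

open scoped NNReal ENNReal MonoidAlgebra

universe u v v₁ v₂ w₁ w₂

noncomputable section

/-! ### Word lengths and quasi-isometries -/

/-- `l` is a word in the letters `s` and `s⁻¹`, `s ∈ S`. -/
def IsWordIn {G : Type*} [Group G] (S : Finset G) (l : List G) : Prop :=
  ∀ x ∈ l, x ∈ S ∨ x⁻¹ ∈ S

/-- The word length `ℓ(g)` with respect to `S`: the minimal length of a word in `S ∪ S⁻¹`
representing `g` (only used when `S` generates the group, so that such a word exists). -/
def wordLength {G : Type*} [Group G] (S : Finset G) (g : G) : ℕ :=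
  sInf {k : ℕ | ∃ l : List G, IsWordIn S l ∧ l.prod = g ∧ l.length = k}

/-- The (left-invariant) word metric `d(g, h) = ℓ(g⁻¹ h)`. -/
def wordDist {G : Type*} [Group G] (S : Finset G) (g h : G) : ℕ :=
  wordLength S (g⁻¹ * h)

/-- `f` is a `(K, K)`-quasi-isometry for the word metrics given by `S` and `T`. -/
structure IsQuasiIsometry {G H : Type*} [Group G] [Group H] (S : Finset G) (T : Finset H)
    (K : ℝ) (f : G → H) : Prop where
  one_le : 1 ≤ K
  upper : ∀ x y : G, (wordDist T (f x) (f y) : ℝ) ≤ K * wordDist S x y + K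
  lower : ∀ x y : G, K⁻¹ * (wordDist S x y : ℝ) - K ≤ wordDist T (f x) (f y)
  coarselySurjective : ∀ z : H, ∃ x : G, (wordDist T (f x) z : ℝ) ≤ K

/-- `G` and `H`, with the word metrics given by `S` and `T`, are quasi-isometric. -/
def QuasiIsometric {G H : Type*} [Group G] [Group H] (S : Finset G) (T : Finset H) : Prop :=
  ∃ (K : ℝ) (f : G → H), IsQuasiIsometry S T K f

/-! ### Projective resolutions of the trivial module -/

/-- The augmentation `RG → R`, `∑ a_g g ↦ ∑ a_g`. The ring `R` need not be commutative. -/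
def augmentation (R G : Type*) [Ring R] [Group G] : R[G] →+* R :=
  MonoidAlgebra.liftNCRingHom (RingHom.id R) (1 : G →* R) (fun x _ => Commute.one_right x)

/-- A projective resolution `⋯ → P₁ → P₀ → R` of the trivial left `RG`-module `R`.
An `RG`-linear map from a module to the trivial module `R` is the same thing as a map to `R`
that is semilinear along the augmentation `RG → R`. -/
structure TrivialResolution (R : Type*) (G : Type*) [Ring R] [Group G] where
  X : ℕ → Type*
  [addCommGroup : ∀ i, AddCommGroup (X i)]
  [module : ∀ i, Module R[G] (X i)]
  projective : ∀ i, Module.Projective R[G] (X i)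
  /-- the differential `∂ : P_{i+1} → P_i` -/
  d : ∀ i, X (i + 1) →ₗ[R[G]] X i
  /-- the augmentation `P₀ → R` -/
  ε : X 0 →ₛₗ[augmentation R G] R
  surjective_ε : Function.Surjective ε
  exact_zero : Function.Exact (d 0) ε
  exact_succ : ∀ i, Function.Exact (d (i + 1)) (d i)

attribute [instance] TrivialResolution.addCommGroup TrivialResolution.module

/-- `c ∈ P_n` is a cycle of the augmented complex `⋯ → P₁ → P₀ → R`. -/
def TrivialResolution.IsCycle {R : Type*} {G : Type*} [Ring R] [Group G]
    (P : TrivialResolution R G) : (n : ℕ) → P.X n → Prop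
  | 0, c => P.ε c = 0
  | n + 1, c => P.d n c = 0

/-- `G` is of type `FP_n(R)`. -/
def IsOfTypeFP (R : Type u) (G : Type v) [Ring R] [Group G] (n : ℕ) : Prop :=
  ∃ P : TrivialResolution.{u, v, max u v} R G, ∀ i ≤ n, Module.Finite R[G] (P.X i)

/-- An `n`-admissible resolution: a projective resolution of the trivial module in which `P_n`
and `P_{n+1}` are finitely generated free, equipped with a choice of finite bases. -/
structure AdmissibleResolution (R : Type*) (G : Type*) [Ring R] [Group G] (n : ℕ)
    extends TrivialResolution R G where
  rank : ℕ
  rank' : ℕ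
  /-- the chosen basis of `P_n` -/
  basis : Module.Basis (Fin rank) R[G] (X n)
  /-- the chosen basis of `P_{n+1}` -/
  basis' : Module.Basis (Fin rank') R[G] (X (n + 1))

/-! ### Norms and filling functions -/

open Classical in
/-- The discrete norm on a ring. -/
def discreteNorm (R : Type*) [Ring R] (x : R) : ℝ≥0 := if x = 0 then 0 else 1

/-- The weighted norm `‖∑ a_γ γ‖^Γ = ∑ |a_γ| (1 + ℓ(γ))` on the group ring, where `|·|` is `ν`. -/
def groupRingWeightedNorm {R G : Type*} [Ring R] [Group G] (ν : R → ℝ≥0) (S : Finset G)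
    (a : R[G]) : ℝ≥0 :=
  ∑ γ ∈ a.coeff.support, ν (a.coeff γ) * (1 + wordLength S γ)

/-- The weighted norm on a free `RG`-module with chosen finite basis `B`:
`‖∑ a_{γb} γb‖^Γ = ∑ |a_{γb}| (1 + ℓ(γ))`. -/
def weightedNorm {R G M : Type*} [Ring R] [Group G] [AddCommGroup M] [Module R[G] M]
    (ν : R → ℝ≥0) (S : Finset G) {k : ℕ} (B : Module.Basis (Fin k) R[G] M) (x : M) : ℝ≥0 :=
  ∑ b, groupRingWeightedNorm ν S (B.repr x b)

namespace AdmissibleResolution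

variable {R G : Type*} [Ring R] [Group G] {n : ℕ}

/-- The weighted filling volume of `c ∈ P_n`: the infimum of `‖b‖^Γ` over `b ∈ P_{n+1}` with
`∂b = c`. -/
def weightedFillingVolume (P : AdmissibleResolution R G n) (ν : R → ℝ≥0) (S : Finset G)
    (c : P.X n) : ℝ≥0∞ :=
  ⨅ (b : P.X (n + 1)) (_ : P.d n b = c), (weightedNorm ν S P.basis' b : ℝ≥0∞)

/-- The weighted filling function that maps `l` to the supremum of the weighted filling volumes
of the cycles `c ∈ P_n` with `‖c‖^Γ ≤ l`. -/
def weightedFillingFunction (P : AdmissibleResolution R G n) (ν : R → ℝ≥0) (S : Finset G)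
    (l : ℝ≥0) : ℝ≥0∞ :=
  ⨆ (c : P.X n) (_ : P.IsCycle n c) (_ : weightedNorm ν S P.basis c ≤ l),
    P.weightedFillingVolume ν S c

/-- The weighted filling function for the discrete norm on `R`, computed from an `n`-admissible
resolution. It fills `n`-cycles by `(n+1)`-chains, and so is the function with index `n + 1` in
the convention that indexes discrete filling functions by the dimension of the fillings. -/
def weightedDiscreteFillingFunction (P : AdmissibleResolution R G n) (S : Finset G) :
    ℝ≥0 → ℝ≥0∞ :=
  P.weightedFillingFunction (discreteNorm R) S

end AdmissibleResolution

/-- `f ≼ g`: there are `C, D > 0` with `f(v) ≤ C g(Cv + D) + Cv + D` for all `v ≥ 0`. -/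
def FillingLE (f g : ℝ≥0 → ℝ≥0∞) : Prop :=
  ∃ C D : ℝ≥0, 0 < C ∧ 0 < D ∧ ∀ v : ℝ≥0, f v ≤ C * g (C * v + D) + C * v + D

/-- `f ≈ g`: both `f ≼ g` and `g ≼ f`. -/
def FillingEquiv (f g : ℝ≥0 → ℝ≥0∞) : Prop :=
  FillingLE f g ∧ FillingLE g f

end

noncomputable section

/-! ### Word lengths -/

section WordLength

variable {G : Type*} [Group G] {S : Finset G}

/-! A quasi-isometry `f` is not a homomorphism, so it induces no equivariant chain map. It does
induce `R`-linear chain maps `u` that are equivariant up to finite ambiguity: for each `m`, all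
elements `f(γ)⁻¹ u(γ m)` lie in one finitely generated `R`-submodule (`IsControlled`). This notion
mentions no norm, so it makes sense in degrees without a basis.

Controlled maps can be constructed degree by degree because resolutions split over `R`
(`exists_contraction`): translate a cycle back by `f(γ)⁻¹`, fill it by the `R`-linear contraction,
which preserves finite generation, and translate forward (`exists_controlled_lift_d`). This yields
controlled maps `φ`, `ψ` over `f` and a coarse inverse `g`, and a controlled homotopy `h` from `φψ`
to the identity on cycles.

The discrete norm enters through one fact: scalars do not increase it, so finitely generated
`R`-submodules are bounded. Hence controlled maps over maps of linear growth are bounded for the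
weighted norms. If `b` fills `ψ c`, then `φ' b + h c` fills `c`, where `φ'` lifts `φ ∂`; this
compares the filling functions. They are finite because the contraction is bounded on norm balls:
only finitely many group elements occur there, and the size of coefficients is invisible. -/

lemma exists_word (hS : Subgroup.closure (S : Set G) = ⊤) (g : G) :
    ∃ l : List G, IsWordIn S l ∧ l.prod = g ∧ l.length = wordLength S g := by
  have hg : g ∈ (Subgroup.closure (S : Set G)).toSubmonoid := by rw [hS]; trivial
  rw [Subgroup.closure_toSubmonoid] at hg
  obtain ⟨l, hl, hprod⟩ := Submonoid.exists_list_of_mem_closure hg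
  exact Nat.sInf_mem
    (s := {k : ℕ | ∃ l : List G, IsWordIn S l ∧ l.prod = g ∧ l.length = k})
    ⟨l.length, l, hl, hprod, rfl⟩

lemma wordLength_le {l : List G} (hl : IsWordIn S l) : wordLength S l.prod ≤ l.length :=
  Nat.sInf_le ⟨l, hl, rfl, rfl⟩

lemma wordLength_mul_le (hS : Subgroup.closure (S : Set G) = ⊤) (g h : G) :
    wordLength S (g * h) ≤ wordLength S g + wordLength S h := by
  obtain ⟨l, hl, rfl, hlen⟩ := exists_word hS g
  obtain ⟨m, hm, rfl, hmlen⟩ := exists_word hS h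
  rw [← hlen, ← hmlen, ← List.prod_append, ← List.length_append]
  refine wordLength_le fun x hx => ?_
  rcases List.mem_append.1 hx with hx | hx
  exacts [hl x hx, hm x hx]

lemma wordLength_inv_le (hS : Subgroup.closure (S : Set G) = ⊤) (g : G) :
    wordLength S g⁻¹ ≤ wordLength S g := by
  obtain ⟨l, hl, rfl, hlen⟩ := exists_word hS g
  rw [← hlen, List.prod_inv_reverse]
  refine (wordLength_le fun x hx => ?_).trans_eq (by simp)
  simp only [List.mem_reverse, List.mem_map] at hx
  obtain ⟨y, hy, rfl⟩ := hx
  rw [inv_inv]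
  exact (hl y hy).symm

lemma finite_wordLength_le (hS : Subgroup.closure (S : Set G) = ⊤) (k : ℕ) :
    {g : G | wordLength S g ≤ k}.Finite := by
  have key : ∀ j : ℕ, {g : G | ∃ l : List G, IsWordIn S l ∧ l.prod = g ∧ l.length = j}.Finite := by
    intro j
    induction j with
    | zero =>
      refine (Set.finite_singleton (1 : G)).subset ?_
      rintro g ⟨l, -, rfl, hl⟩
      simp [List.length_eq_zero_iff.1 hl]
    | succ j ih =>
      have hA : {x : G | x ∈ S ∨ x⁻¹ ∈ S}.Finite := by
        refine S.finite_toSet.union (Set.Finite.preimage inv_injective.injOn S.finite_toSet)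
      refine (hA.image2 (· * ·) ih).subset ?_
      rintro g ⟨l, hl, rfl, hlen⟩
      cases l with
      | nil => simp at hlen
      | cons a l =>
        exact ⟨a, hl a (by simp), l.prod,
          ⟨l, fun x hx => hl x (by simp [hx]), rfl, by simpa using hlen⟩, by simp⟩
  refine ((Set.finite_Iic k).biUnion fun j _ => key j).subset fun g hg => ?_
  simp only [Set.mem_iUnion]
  exact ⟨wordLength S g, hg, exists_word hS g⟩

lemma wordDist_triangle (hS : Subgroup.closure (S : Set G) = ⊤) (x y z : G) :
    wordDist S x z ≤ wordDist S x y + wordDist S y z := by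
  refine le_of_eq_of_le ?_ (wordLength_mul_le hS (x⁻¹ * y) (y⁻¹ * z))
  simp [wordDist, mul_assoc]

lemma wordDist_le_comm (hS : Subgroup.closure (S : Set G) = ⊤) (x y : G) :
    wordDist S x y ≤ wordDist S y x := by
  refine le_of_eq_of_le ?_ (wordLength_inv_le hS (y⁻¹ * x))
  simp [wordDist]

/-- Balls are finite, so a metric bound becomes a finiteness statement about group elements. Control
of linear maps uses only the latter. -/
lemma finite_range_of_wordDist_le (hS : Subgroup.closure (S : Set G) = ⊤) {ι : Type*}
    {a b : ι → G} {C : ℝ} (h : ∀ i, (wordDist S (a i) (b i) : ℝ) ≤ C) :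
    (Set.range fun i => (a i)⁻¹ * b i).Finite := by
  refine (finite_wordLength_le hS ⌊C⌋₊).subset ?_
  rintro _ ⟨i, rfl⟩
  exact Nat.le_floor (h i)

end WordLength

/-! ### Coarse maps -/

/-- A map that moves points at bounded distance to points at bounded distance. -/
def IsBornologous {G H : Type*} [Group G] [Group H] (f : G → H) : Prop :=
  ∀ g : G, (Set.range fun x => (f x)⁻¹ * f (x * g)).Finite

/-- Two maps into a group that differ by right multiplication by finitely many elements. -/
def AreClose {X H : Type*} [Group H] (f f' : X → H) : Prop :=
  (Set.range fun x => (f x)⁻¹ * f' x).Finite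

/-- The word length grows at most linearly under `f`. -/
def HasLinearGrowth {G H : Type*} [Group G] [Group H] (S : Finset G) (T : Finset H)
    (f : G → H) : Prop :=
  ∃ C : ℝ≥0, ∀ x, (1 + wordLength T (f x) : ℝ≥0) ≤ C * (1 + wordLength S x)

section Coarse

variable {G H : Type*} [Group G] [Group H] {S : Finset G} {T : Finset H}

lemma isBornologous_id : IsBornologous (id : G → G) := fun g =>
  (Set.finite_singleton g).subset (by rintro _ ⟨x, rfl⟩; simp)

lemma hasLinearGrowth_id : HasLinearGrowth S S id := ⟨1, fun x => by simp⟩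

/-- A map of groups that is Lipschitz on the large scale. -/
def IsCoarseLipschitz (S : Finset G) (T : Finset H) (f : G → H) : Prop :=
  ∃ C : ℝ, 0 ≤ C ∧ ∀ x y, (wordDist T (f x) (f y) : ℝ) ≤ C * wordDist S x y + C

lemma IsCoarseLipschitz.isBornologous (hT : Subgroup.closure (T : Set H) = ⊤) {f : G → H}
    (hf : IsCoarseLipschitz S T f) : IsBornologous f := fun g => by
  obtain ⟨C, -, hC⟩ := hf
  refine finite_range_of_wordDist_le hT (C := C * wordLength S g + C) fun x => ?_
  simpa [wordDist] using hC x (x * g)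

lemma IsCoarseLipschitz.hasLinearGrowth (hT : Subgroup.closure (T : Set H) = ⊤) {f : G → H}
    (hf : IsCoarseLipschitz S T f) : HasLinearGrowth S T f := by
  obtain ⟨C, hC0, hC⟩ := hf
  -- Comparing with the base point gives `ℓ(f x) ≤ ℓ(f 1) + C ℓ(x) + C`.
  refine ⟨1 + wordLength T (f 1) + C.toNNReal, fun x => ?_⟩
  rw [← NNReal.coe_le_coe]
  push_cast
  rw [Real.coe_toNNReal C hC0]
  have h1 : (wordDist T (f 1) (f x) : ℝ) ≤ C * wordLength S x + C := by
    simpa [wordDist] using hC 1 x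
  have h2 : (wordLength T (f x) : ℝ) ≤ wordLength T (f 1) + wordDist T (f 1) (f x) := by
    have := wordLength_mul_le hT (f 1) ((f 1)⁻¹ * f x)
    rw [mul_inv_cancel_left] at this
    exact_mod_cast this
  have h3 : (0 : ℝ) ≤ wordLength T (f 1) * wordLength S x := by positivity
  have h4 : (0 : ℝ) ≤ wordLength S x := by positivity
  linarith

/-- A quasi-isometry of finitely generated groups has a coarse inverse. -/
lemma QuasiIsometric.exists_coarse_inverse (hS : Subgroup.closure (S : Set G) = ⊤)
    (hT : Subgroup.closure (T : Set H) = ⊤) (h : QuasiIsometric S T) :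
    ∃ (f : G → H) (g : H → G), IsCoarseLipschitz S T f ∧ IsCoarseLipschitz T S g ∧
      AreClose id (f ∘ g) ∧ AreClose id (g ∘ f) := by
  obtain ⟨K, f, hf⟩ := h
  choose g hg using hf.coarselySurjective
  have hK : 0 < K := one_pos.trans_le hf.one_le
  have lower : ∀ x y, (wordDist S x y : ℝ) ≤ K * (wordDist T (f x) (f y) + K) := by
    intro x y
    have := mul_le_mul_of_nonneg_left (hf.lower x y) hK.le
    rw [mul_sub, mul_inv_cancel_left₀ hK.ne'] at this
    linarith
  have hg' : ∀ z, (wordDist T z (f (g z)) : ℝ) ≤ K := fun z =>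
    (Nat.cast_le.2 (wordDist_le_comm hT _ _)).trans (hg z)
  -- Pulling back through `f` costs `K (d + K)`, and replacing `f (g x)`, `f (g y)` by `x`, `y`
  -- costs `2K` inside `d`; together this is `K d + 3 K²`.
  refine ⟨f, g, ⟨K, hK.le, hf.upper⟩, ⟨K + 3 * K * K, by positivity, fun x y => ?_⟩, ?_, ?_⟩
  · have h1 := lower (g x) (g y)
    have h2 : (wordDist T (f (g x)) (f (g y)) : ℝ) ≤ K + wordDist T x y + K := by
      have a := wordDist_triangle hT (f (g x)) x (f (g y))
      have b := wordDist_triangle hT x y (f (g y))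
      have a' : (wordDist T (f (g x)) (f (g y)) : ℝ) ≤
        wordDist T (f (g x)) x + (wordDist T x y + wordDist T y (f (g y))) := by
        exact_mod_cast a.trans (by omega)
      linarith [hg x, hg' y]
    have h3 := mul_le_mul_of_nonneg_left h2 hK.le
    have h4 : 0 ≤ K * K * (wordDist T x y : ℝ) := by positivity
    nlinarith
  · exact finite_range_of_wordDist_le hT (C := K) hg'
  · refine finite_range_of_wordDist_le hS (C := K * (K + K)) fun x => (lower _ _).trans ?_
    have := hg' (f x)
    simp only [id, Function.comp]
    gcongr

end Coarse

/-! ### Controlled maps -/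

section Controlled

variable {R : Type*} [Ring R]
  {G : Type*} [Group G] {H : Type*} [Group H] {K : Type*} [Group K]
  {M : Type*} [AddCommGroup M] [Module R M] [Module R[G] M] [IsScalarTower R R[G] M]
  {N : Type*} [AddCommGroup N] [Module R N] [Module R[H] N] [IsScalarTower R R[H] N]
  {L : Type*} [AddCommGroup L] [Module R L] [Module R[K] L] [IsScalarTower R R[K] L]

lemma smul_eq_single_smul (r : R) (m : M) : r • m = (MonoidAlgebra.single 1 r : R[G]) • m := by
  rw [← one_smul R[G] m, ← smul_assoc, one_smul, MonoidAlgebra.one_def, MonoidAlgebra.smul_single,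
    smul_eq_mul, mul_one]

variable (R) in
/-- The action of a group element on an `R[G]`-module, as an `R`-linear map. -/
def groupAct (g : G) : M →ₗ[R] M where
  toFun m := (MonoidAlgebra.single g 1 : R[G]) • m
  map_add' := smul_add _
  map_smul' r m := by
    -- Coefficients commute with group elements in `R[G]`, even when `R` is not commutative.
    rw [RingHom.id_apply, smul_eq_single_smul (G := G) r m,
      smul_eq_single_smul (G := G) r (MonoidAlgebra.single g 1 • m),
      smul_smul, smul_smul, MonoidAlgebra.single_mul_single, MonoidAlgebra.single_mul_single,
      mul_one, one_mul, mul_one, one_mul]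

lemma groupAct_apply (g : G) (m : M) :
    groupAct R g m = (MonoidAlgebra.single g 1 : R[G]) • m := rfl

lemma single_smul_eq (g : G) (r : R) (m : M) :
    (MonoidAlgebra.single g r : R[G]) • m = r • groupAct R g m := by
  rw [groupAct_apply, ← smul_assoc, MonoidAlgebra.smul_single, smul_eq_mul, mul_one]

lemma groupAct_mul (g h : G) (m : M) :
    groupAct R (g * h) m = groupAct R g (groupAct R h m) := by
  simp only [groupAct_apply, smul_smul, MonoidAlgebra.single_mul_single, mul_one]

@[simp] lemma groupAct_one (m : M) : groupAct R (1 : G) m = m := by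
  rw [groupAct_apply, ← MonoidAlgebra.one_def, one_smul]

@[simp] lemma groupAct_inv_groupAct (g : G) (m : M) :
    groupAct R g⁻¹ (groupAct R g m) = m := by
  rw [← groupAct_mul, inv_mul_cancel, groupAct_one]

@[simp] lemma groupAct_groupAct_inv (g : G) (m : M) :
    groupAct R g (groupAct R g⁻¹ m) = m := by
  rw [← groupAct_mul, mul_inv_cancel, groupAct_one]

lemma map_groupAct {M' : Type*} [AddCommGroup M'] [Module R M'] [Module R[G] M']
    [IsScalarTower R R[G] M'] (u : M →ₗ[R[G]] M') (g : G) (m : M) :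
    u (groupAct R g m) = groupAct R g (u m) := map_smul u _ _

/-- `u` is controlled over `f` at `m`: the elements `f(γ)⁻¹ u(γ m)` lie in a finitely generated
`R`-module. -/
def IsControlledAt (f : G → H) (u : M →ₗ[R] N) (m : M) : Prop :=
  ∃ W : Submodule R N, W.FG ∧ ∀ γ : G, groupAct R (f γ)⁻¹ (u (groupAct R γ m)) ∈ W

/-- An `R`-linear map that is equivariant over `f : G → H` up to finite ambiguity. -/
def IsControlled (f : G → H) (u : M →ₗ[R] N) : Prop := ∀ m, IsControlledAt f u m

lemma exists_fg_of_forall_mem {ι : Type*} {s : Set ι} (hs : s.Finite) {P : ι → N → Prop}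
    (h : ∀ i ∈ s, ∃ W : Submodule R N, W.FG ∧ ∀ x, P i x → x ∈ W) :
    ∃ W : Submodule R N, W.FG ∧ ∀ i ∈ s, ∀ x, P i x → x ∈ W := by
  have : Finite s := hs
  choose W hW hPW using fun i : s => h i i.2
  exact ⟨⨆ i, W i, Submodule.fg_iSup W hW, fun i hi x hx =>
    Submodule.mem_iSup_of_mem ⟨i, hi⟩ (hPW ⟨i, hi⟩ x hx)⟩

lemma exists_fg_translates {W : Submodule R N} (hW : W.FG) {s : Set H} (hs : s.Finite) :
    ∃ V : Submodule R N, V.FG ∧ ∀ h ∈ s, ∀ w ∈ W, groupAct R h w ∈ V := by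
  obtain ⟨V, hV, hWV⟩ := exists_fg_of_forall_mem hs
    (P := fun h x => ∃ w ∈ W, groupAct R h w = x)
    fun h _ => ⟨W.map (groupAct R h), hW.map _, fun x hx => hx⟩
  exact ⟨V, hV, fun h hh w hw => hWV h hh _ ⟨w, hw, rfl⟩⟩

lemma IsControlledAt.add {f : G → H} {u : M →ₗ[R] N} {x y : M} (hx : IsControlledAt f u x)
    (hy : IsControlledAt f u y) : IsControlledAt f u (x + y) := by
  obtain ⟨V, hV, hxV⟩ := hx
  obtain ⟨W, hW, hyW⟩ := hy
  refine ⟨V ⊔ W, hV.sup hW, fun γ => ?_⟩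
  simp only [map_add]
  exact Submodule.add_mem_sup (hxV γ) (hyW γ)

lemma IsControlledAt.smul {f : G → H} {u : M →ₗ[R] N} {x : M} (hx : IsControlledAt f u x) (r : R) :
    IsControlledAt f u (r • x) := by
  obtain ⟨V, hV, hxV⟩ := hx
  refine ⟨V, hV, fun γ => ?_⟩
  simp only [map_smul]
  exact V.smul_mem r (hxV γ)

lemma isControlledAt_zero {f : G → H} {u : M →ₗ[R] N} : IsControlledAt f u 0 :=
  ⟨⊥, Submodule.fg_bot, by simp⟩

/-- Write `f(γ)⁻¹ u(γ g x)` as `f(γ)⁻¹ f(γ g)` applied to `f(γ g)⁻¹ u(γ g x)`; the first factor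
takes finitely many values because `f` is bornologous. -/
lemma IsControlledAt.groupAct {f : G → H} (hf : IsBornologous f) {u : M →ₗ[R] N} {x : M}
    (hx : IsControlledAt f u x) (g : G) : IsControlledAt f u (groupAct R g x) := by
  obtain ⟨W, hW, hxW⟩ := hx
  obtain ⟨V, hV, hWV⟩ := exists_fg_translates hW (hf g)
  refine ⟨V, hV, fun γ => ?_⟩
  have := hWV _ ⟨γ, rfl⟩ _ (hxW (γ * g))
  rwa [groupAct_mul, groupAct_groupAct_inv, groupAct_mul] at this

lemma IsControlled.of_areClose {f f' : G → H} (h : AreClose f' f) {u : M →ₗ[R] N}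
    (hu : IsControlled f u) : IsControlled f' u := fun m => by
  obtain ⟨W, hW, hmW⟩ := hu m
  obtain ⟨V, hV, hWV⟩ := exists_fg_translates hW h
  refine ⟨V, hV, fun γ => ?_⟩
  have := hWV _ ⟨γ, rfl⟩ _ (hmW γ)
  rwa [groupAct_mul, groupAct_groupAct_inv] at this

/-- Makes control uniform over a finitely generated submodule, as composing controlled maps
requires; by `R`-linearity, generators suffice. -/
lemma IsControlled.exists_fg {f : G → H} {u : M →ₗ[R] N} (hu : IsControlled f u)
    {W : Submodule R M} (hW : W.FG) :
    ∃ V : Submodule R N, V.FG ∧ ∀ γ, ∀ w ∈ W, groupAct R (f γ)⁻¹ (u (groupAct R γ w)) ∈ V := by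
  obtain ⟨s, hs, rfl⟩ := Submodule.fg_def.1 hW
  obtain ⟨V, hV, hsV⟩ := exists_fg_of_forall_mem hs
    (P := fun m x => ∃ γ, groupAct R (f γ)⁻¹ (u (groupAct R γ m)) = x) fun m _ => by
      obtain ⟨V, hV, hmV⟩ := hu m
      exact ⟨V, hV, by rintro _ ⟨γ, rfl⟩; exact hmV γ⟩
  refine ⟨V, hV, fun γ w hw => ?_⟩
  have : Submodule.span R s ≤ V.comap (groupAct R (f γ)⁻¹ ∘ₗ u ∘ₗ groupAct R γ) :=
    Submodule.span_le.2 fun m hm => hsV m hm _ ⟨γ, rfl⟩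
  exact this hw

lemma IsControlled.comp {f : G → H} {f' : H → K} {u : M →ₗ[R] N} {u' : N →ₗ[R] L}
    (hu' : IsControlled f' u') (hu : IsControlled f u) : IsControlled (f' ∘ f) (u' ∘ₗ u) :=
  fun m => by
  obtain ⟨W, hW, hmW⟩ := hu m
  obtain ⟨V, hV, hWV⟩ := hu'.exists_fg hW
  refine ⟨V, hV, fun γ => ?_⟩
  have := hWV (f γ) _ (hmW γ)
  rwa [groupAct_groupAct_inv] at this

lemma IsControlled.sub {f : G → H} {u u' : M →ₗ[R] N} (hu : IsControlled f u)
    (hu' : IsControlled f u') : IsControlled f (u - u') := fun m => by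
  obtain ⟨V, hV, hmV⟩ := hu m
  obtain ⟨W, hW, hmW⟩ := hu' m
  refine ⟨V ⊔ W, hV.sup hW, fun γ => ?_⟩
  rw [LinearMap.sub_apply, map_sub]
  exact sub_mem (Submodule.mem_sup_left (hmV γ)) (Submodule.mem_sup_right (hmW γ))

lemma isControlled_id {M' : Type*} [AddCommGroup M'] [Module R M'] [Module R[G] M']
    [IsScalarTower R R[G] M'] (u : M →ₗ[R[G]] M') :
    IsControlled (id : G → G) (u.restrictScalars R) := fun m =>
  ⟨Submodule.span R {u m}, Submodule.fg_span_singleton _, fun γ => by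
    rw [LinearMap.restrictScalars_apply, map_groupAct, id, groupAct_inv_groupAct]
    exact Submodule.mem_span_singleton_self _⟩

/-! ### Linear maps on free and projective modules -/

lemma groupAct_ext {A : Type*} [AddCommGroup A] [Module R A] {ι : Type*}
    {u u' : (ι →₀ R[G]) →ₗ[R] A}
    (h : ∀ i (γ : G), u (groupAct R γ (Finsupp.single i (1 : R[G]))) =
      u' (groupAct R γ (Finsupp.single i (1 : R[G])))) : u = u' := by
  refine LinearMap.toAddMonoidHom_injective (Finsupp.addHom_ext' fun i =>
    MonoidAlgebra.addMonoidHom_ext fun γ r => ?_)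
  have : Finsupp.single i (MonoidAlgebra.single γ r : R[G]) =
      r • groupAct R γ (Finsupp.single i (1 : R[G])) := by
    rw [← single_smul_eq, Finsupp.smul_single, smul_eq_mul, mul_one]
  simp [this, h]

lemma IsControlled.of_basis {ι : Type*} {f : G → H} (hf : IsBornologous f)
    {u : (ι →₀ R[G]) →ₗ[R] N} (h : ∀ i, IsControlledAt f u (Finsupp.single i (1 : R[G]))) :
    IsControlled f u := fun m => by
  induction m using Finsupp.induction_linear with
  | zero => exact isControlledAt_zero
  | add x y hx hy => exact hx.add hy
  | single i a =>
    induction a using MonoidAlgebra.induction_linear with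
    | zero => rw [Finsupp.single_zero]; exact isControlledAt_zero
    | add x y hx hy => rw [Finsupp.single_add]; exact hx.add hy
    | single γ r =>
      have : Finsupp.single i (MonoidAlgebra.single γ r : R[G]) =
          r • groupAct R γ (Finsupp.single i (1 : R[G])) := by
        rw [← single_smul_eq, Finsupp.smul_single, smul_eq_mul, mul_one]
      rw [this]
      exact ((h i).groupAct hf γ).smul r

lemma exists_linearMap_groupAct_single {A : Type*} [AddCommGroup A] [Module R A] {ι : Type*}
    (v : ι → G → A) : ∃ u : (ι →₀ R[G]) →ₗ[R] A,
      ∀ i (γ : G), u (groupAct R γ (Finsupp.single i (1 : R[G]))) = v i γ := by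
  let c : R[G] →ₗ[R] (G →₀ R) :=
    { toFun := MonoidAlgebra.coeff, map_add' := fun _ _ => rfl, map_smul' := fun _ _ => rfl }
  -- The scalars are `ℕ` because `R`-linear maps form no `R`-module over a noncommutative `R`.
  refine ⟨Finsupp.lsum ℕ fun i => Finsupp.linearCombination R (v i) ∘ₗ c, fun i γ => ?_⟩
  rw [groupAct_apply, Finsupp.smul_single, smul_eq_mul, mul_one, Finsupp.lsum_single]
  change Finsupp.linearCombination R (v i) (Finsupp.single γ 1) = v i γ
  simp

/-- An `R`-linear map on a projective `R[G]`-module lifts as soon as it lifts pointwise, through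
an `R[G]`-linear map to a free module and an `R`-linear map with prescribed values. -/
lemma exists_lift_through_free [Module.Projective R[G] M] {A B : Type*} [AddCommGroup A]
    [Module R A] [AddCommGroup B] [Module R B] (p : A →ₗ[R] B) (u : M →ₗ[R] B) (v : M → G → A)
    (hv : ∀ m γ, p (v m γ) = u (groupAct R γ m)) :
    ∃ (s : M →ₗ[R[G]] M →₀ R[G]) (Φ : (M →₀ R[G]) →ₗ[R] A),
      (∀ m (γ : G), Φ (groupAct R γ (Finsupp.single m (1 : R[G]))) = v m γ) ∧
      p ∘ₗ Φ ∘ₗ s.restrictScalars R = u := by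
  obtain ⟨s, hs⟩ := Module.projective_def'.1 (inferInstance : Module.Projective R[G] M)
  obtain ⟨Φ, hΦ⟩ := exists_linearMap_groupAct_single (R := R) v
  -- The elements `γ e_m` span the free module over `R`, so equality there suffices; precomposing
  -- with the section `s` then recovers `u`.
  have key : p ∘ₗ Φ = u ∘ₗ (Finsupp.linearCombination R[G] (id : M → M)).restrictScalars R :=
    groupAct_ext fun m γ => by simp [hΦ, hv, map_groupAct]
  refine ⟨s, Φ, hΦ, LinearMap.ext fun m => ?_⟩
  have h1 := LinearMap.congr_fun key (s m)
  have h2 := LinearMap.congr_fun hs m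
  simp only [LinearMap.comp_apply, LinearMap.restrictScalars_apply, LinearMap.id_apply] at h1 h2 ⊢
  rw [h1, h2]

/-- `R[G]` is free over `R`, so projective `R[G]`-modules are projective over `R`. -/
lemma exists_lift (G : Type*) [Group G] [Module R[G] M] [IsScalarTower R R[G] M]
    [Module.Projective R[G] M] {A B : Type*} [AddCommGroup A] [Module R A]
    [AddCommGroup B] [Module R B] (p : A →ₗ[R] B) (u : M →ₗ[R] B) (h : ∀ m, ∃ a, p a = u m) :
    ∃ u' : M →ₗ[R] A, p ∘ₗ u' = u := by
  choose v hv using h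
  obtain ⟨s, Φ, -, h⟩ := exists_lift_through_free p u (fun m (γ : G) => v (groupAct R γ m))
    fun m γ => hv _
  exact ⟨_, h⟩

/-- Controlled lifting along an `R`-linear map. -/
lemma exists_controlled_lift [Module.Projective R[G] M] {B : Type*} [AddCommGroup B] [Module R B]
    {f : G → H} (hf : IsBornologous f) (p : N →ₗ[R] B) (u : M →ₗ[R] B)
    (h : ∀ m, ∃ W : Submodule R N, W.FG ∧ ∀ γ, ∃ w ∈ W,
      p (groupAct R (f γ) w) = u (groupAct R γ m)) :
    ∃ u' : M →ₗ[R] N, IsControlled f u' ∧ p ∘ₗ u' = u := by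
  choose W hW v hvW hv using h
  -- The value at `γ e_m` is `f(γ) (v m γ)`, so translating back by `f(γ)⁻¹` lands in `W m`.
  obtain ⟨s, Φ, hΦ, h⟩ := exists_lift_through_free p u (fun m γ => groupAct R (f γ) (v m γ)) hv
  have hΦc : IsControlled f Φ := .of_basis hf fun m => ⟨W m, hW m, fun γ => by
    rw [hΦ, groupAct_inv_groupAct]; exact hvW m γ⟩
  exact ⟨_, hΦc.comp (isControlled_id s), h⟩

end Controlled

/-! ### Chain maps between resolutions -/

namespace TrivialResolution

variable {R : Type*} [Ring R] {G : Type*} [Group G] {H : Type*} [Group H]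

instance (P : TrivialResolution R G) (i : ℕ) : Module R (P.X i) :=
  Module.compHom (P.X i) (MonoidAlgebra.singleOneRingHom : R →+* R[G])

lemma smul_def (P : TrivialResolution R G) {i : ℕ} (r : R) (x : P.X i) :
    r • x = (MonoidAlgebra.single 1 r : R[G]) • x := rfl

instance (P : TrivialResolution R G) (i : ℕ) : IsScalarTower R R[G] (P.X i) where
  smul_assoc r a x := by
    rw [smul_def, smul_smul]
    congr 1
    ext g
    rw [MonoidAlgebra.coeff_single_one_mul, MonoidAlgebra.coeff_smul, Finsupp.smul_apply,
      smul_eq_mul]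

instance (P : TrivialResolution R G) (i : ℕ) : Module.Projective R[G] (P.X i) := P.projective i

variable (P : TrivialResolution R G) (Q : TrivialResolution R H)

/-- The differential as an `R`-linear map. -/
def dₗ (i : ℕ) : P.X (i + 1) →ₗ[R] P.X i := (P.d i).restrictScalars R

@[simp] lemma dₗ_apply (i : ℕ) (x : P.X (i + 1)) : P.dₗ i x = P.d i x := rfl

lemma augmentation_single (g : G) (r : R) :
    augmentation R G (MonoidAlgebra.single g r) = r := by
  simp [augmentation]

/-- The augmentation `P₀ → R` as an `R`-linear map. -/
def εₗ : P.X 0 →ₗ[R] R where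
  toFun := P.ε
  map_add' := map_add _
  map_smul' r x := by rw [smul_def, map_smulₛₗ, augmentation_single]; rfl

@[simp] lemma εₗ_apply (x : P.X 0) : P.εₗ x = P.ε x := rfl

@[simp] lemma ε_groupAct (g : G) (x : P.X 0) : P.ε (groupAct R g x) = P.ε x := by
  rw [groupAct_apply, map_smulₛₗ, augmentation_single, one_smul]

variable {P Q}

lemma isCycle_d {i : ℕ} (x : P.X (i + 1)) : P.IsCycle i (P.d i x) := by
  cases i with
  | zero => exact P.exact_zero.apply_apply_eq_zero x
  | succ i => exact (P.exact_succ i).apply_apply_eq_zero x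

lemma IsCycle.exists_eq_d {i : ℕ} {z : P.X i} (hz : P.IsCycle i z) : ∃ x, P.d i x = z := by
  cases i with
  | zero => exact (P.exact_zero z).1 hz
  | succ i => exact (P.exact_succ i z).1 hz

lemma IsCycle.sub {i : ℕ} {x y : P.X i} (hx : P.IsCycle i x) (hy : P.IsCycle i y) :
    P.IsCycle i (x - y) := by
  obtain ⟨a, rfl⟩ := hx.exists_eq_d
  obtain ⟨b, rfl⟩ := hy.exists_eq_d
  rw [← map_sub]
  exact isCycle_d _

lemma IsCycle.groupAct {i : ℕ} {x : P.X i} (hx : P.IsCycle i x) (g : G) :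
    P.IsCycle i (groupAct R g x) := by
  obtain ⟨a, rfl⟩ := hx.exists_eq_d
  rw [← map_groupAct]
  exact isCycle_d _

/-! ### Contractions and controlled lifting -/

lemma exists_lift_d {i : ℕ} (u : P.X i →ₗ[R] Q.X i) (hu : ∀ x, Q.IsCycle i (u x)) :
    ∃ u' : P.X i →ₗ[R] Q.X (i + 1), ∀ x, Q.d i (u' x) = u x := by
  obtain ⟨u', h⟩ := exists_lift G (Q.dₗ i) u fun x => (hu x).exists_eq_d
  exact ⟨u', fun x => LinearMap.congr_fun h x⟩

variable (P) in
/-- Cycles bound `R`-linearly. -/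
lemma exists_contraction (i : ℕ) :
    ∃ s : P.X i →ₗ[R] P.X (i + 1), ∀ z, P.IsCycle i z → P.d i (s z) = z := by
  induction i with
  | zero =>
    obtain ⟨x, hx⟩ := P.surjective_ε 1
    have hx' (y : P.X 0) : P.ε (P.ε y • x) = P.ε y := by
      rw [← εₗ_apply, map_smul, εₗ_apply, hx, smul_eq_mul, mul_one]
    -- Subtracting `ε(y) x` makes every `y` a cycle and leaves cycles unchanged. In higher degrees
    -- `s (∂ y)` plays this role.
    obtain ⟨s, hs⟩ := exists_lift_d (P := P) (Q := P) (i := 0)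
      (LinearMap.id - (LinearMap.toSpanSingleton R (P.X 0) x) ∘ₗ P.εₗ) fun y => by
        change P.ε (y - P.ε y • x) = 0
        rw [map_sub, hx', sub_self]
    refine ⟨s, fun z hz => ?_⟩
    rw [hs]
    change z - P.ε z • x = z
    rw [show P.ε z = 0 from hz, zero_smul, sub_zero]
  | succ i ih =>
    obtain ⟨s, hs⟩ := ih
    obtain ⟨s', hs'⟩ := exists_lift_d (P := P) (Q := P) (i := i + 1)
      (LinearMap.id - s ∘ₗ P.dₗ i) fun y => by
        change P.d i (y - s (P.d i y)) = 0
        rw [map_sub, hs _ (isCycle_d y), sub_self]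
    refine ⟨s', fun z hz => ?_⟩
    rw [hs']
    change z - s (P.d i z) = z
    rw [show P.d i z = 0 from hz, map_zero, sub_zero]

/-- The contraction `s` is not equivariant, but it is applied only to the translates `f(γ)⁻¹ u(γ
m)`. These lie in a finitely generated `W`, so their fillings lie in the finitely generated `s(W)`.
-/
lemma exists_controlled_lift_d {M : Type*} [AddCommGroup M] [Module R M] [Module R[G] M]
    [IsScalarTower R R[G] M] [Module.Projective R[G] M] {f : G → H} (hf : IsBornologous f) {i : ℕ}
    {u : M →ₗ[R] Q.X i} (hu : IsControlled f u) (huc : ∀ x, Q.IsCycle i (u x)) :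
    ∃ u' : M →ₗ[R] Q.X (i + 1), IsControlled f u' ∧ ∀ x, Q.d i (u' x) = u x := by
  obtain ⟨s, hs⟩ := Q.exists_contraction i
  obtain ⟨u', hu', h⟩ := exists_controlled_lift hf (Q.dₗ i) u fun m => by
    obtain ⟨W, hW, hmW⟩ := hu m
    refine ⟨W.map s, hW.map s, fun γ => ⟨_, Submodule.mem_map_of_mem (hmW γ), ?_⟩⟩
    rw [dₗ_apply, map_groupAct, hs _ ((huc _).groupAct _), groupAct_groupAct_inv]
  exact ⟨u', hu', fun x => LinearMap.congr_fun h x⟩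

variable (P Q) in
lemma exists_controlled_augmentation_lift {f : G → H} (hf : IsBornologous f) :
    ∃ φ : P.X 0 →ₗ[R] Q.X 0, IsControlled f φ ∧ ∀ x, Q.ε (φ x) = P.ε x := by
  obtain ⟨y, hy⟩ := Q.surjective_ε 1
  obtain ⟨φ, hφ, h⟩ := exists_controlled_lift hf Q.εₗ P.εₗ fun m => by
    refine ⟨_, Submodule.fg_span_singleton y, fun γ => ⟨P.ε m • y,
      Submodule.smul_mem _ _ (Submodule.mem_span_singleton_self y), ?_⟩⟩
    rw [εₗ_apply, εₗ_apply, ε_groupAct, ε_groupAct, ← εₗ_apply, map_smul, εₗ_apply, hy,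
      smul_eq_mul, mul_one]
  exact ⟨φ, hφ, fun x => LinearMap.congr_fun h x⟩

/-- Over a coarse equivalence, two resolutions are controlled homotopy equivalent. -/
lemma exists_controlled_homotopyEquiv (P : TrivialResolution R G) (Q : TrivialResolution R H)
    {f : G → H} {g : H → G} (hf : IsBornologous f)
    (hg : IsBornologous g) (hfg : AreClose id (f ∘ g)) (i : ℕ) :
    ∃ (φ : P.X i →ₗ[R] Q.X i) (ψ : Q.X i →ₗ[R] P.X i) (h : Q.X i →ₗ[R] Q.X (i + 1)),
      IsControlled f φ ∧ IsControlled g ψ ∧ IsControlled (id : H → H) h ∧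
      (∀ z, P.IsCycle i z → Q.IsCycle i (φ z)) ∧ (∀ z, Q.IsCycle i z → P.IsCycle i (ψ z)) ∧
      ∀ z, Q.IsCycle i z → Q.d i (h z) = z - φ (ψ z) := by
  induction i with
  | zero =>
    obtain ⟨φ, hφ, hφε⟩ := P.exists_controlled_augmentation_lift Q hf
    obtain ⟨ψ, hψ, hψε⟩ := Q.exists_controlled_augmentation_lift P hg
    -- `φ ψ` is controlled over `f ∘ g`, hence over the identity by closeness.
    obtain ⟨h, hh, hd⟩ := exists_controlled_lift_d (Q := Q) (i := 0) isBornologous_id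
      ((isControlled_id (LinearMap.id : Q.X 0 →ₗ[R[H]] Q.X 0)).sub
        ((hφ.comp hψ).of_areClose hfg)) fun x => by
        change Q.ε (x - φ (ψ x)) = 0
        rw [map_sub, hφε, hψε, sub_self]
    exact ⟨φ, ψ, h, hφ, hψ, hh, fun z hz => (hφε z).trans hz, fun z hz => (hψε z).trans hz,
      fun z _ => hd z⟩
  | succ i ih =>
    obtain ⟨φ, ψ, h, hφ, hψ, hh, hφc, hψc, hd⟩ := ih
    obtain ⟨φ', hφ', hφd⟩ := exists_controlled_lift_d hf (hφ.comp (isControlled_id (P.d i)))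
      fun x => hφc _ (isCycle_d x)
    obtain ⟨ψ', hψ', hψd⟩ := exists_controlled_lift_d hg (hψ.comp (isControlled_id (Q.d i)))
      fun x => hψc _ (isCycle_d x)
    simp only [LinearMap.comp_apply, LinearMap.restrictScalars_apply] at hφd hψd
    -- The term `h ∂` makes `id - φ' ψ' - h ∂` take values in cycles; it vanishes on cycles, giving
    -- the required formula.
    obtain ⟨h', hh', hd'⟩ := exists_controlled_lift_d (Q := Q) (i := i + 1) isBornologous_id
      (((isControlled_id (LinearMap.id : Q.X (i + 1) →ₗ[R[H]] Q.X (i + 1))).sub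
        ((hφ'.comp hψ').of_areClose hfg)).sub (hh.comp (isControlled_id (Q.d i)))) fun x => by
        change Q.d i (x - φ' (ψ' x) - h (Q.d i x)) = 0
        rw [map_sub, map_sub, hφd, hψd, hd _ (isCycle_d x), sub_self]
    refine ⟨φ', ψ', h', hφ', hψ', hh', fun z hz => ?_, fun z hz => ?_, fun z hz => ?_⟩
    · change Q.d i (φ' z) = 0
      rw [hφd, show P.d i z = 0 from hz, map_zero]
    · change P.d i (ψ' z) = 0
      rw [hψd, show Q.d i z = 0 from hz, map_zero]
    · rw [hd']
      change z - φ' (ψ' z) - h (Q.d i z) = _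
      rw [show Q.d i z = 0 from hz, map_zero, sub_zero]

end TrivialResolution

/-! ### Weighted norms -/

section Norm

variable {R : Type*} [Ring R] {G : Type*} [Group G] {S : Finset G} {H : Type*} [Group H]
  {T : Finset H}

lemma groupRingWeightedNorm_discrete (a : R[G]) :
    groupRingWeightedNorm (discreteNorm R) S a =
      ∑ γ ∈ a.coeff.support, (1 + wordLength S γ : ℝ≥0) :=
  Finset.sum_congr rfl fun γ hγ => by
    rw [discreteNorm, if_neg (Finsupp.mem_support_iff.1 hγ), one_mul]

lemma groupRingWeightedNorm_add_le (a b : R[G]) :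
    groupRingWeightedNorm (discreteNorm R) S (a + b) ≤
      groupRingWeightedNorm (discreteNorm R) S a + groupRingWeightedNorm (discreteNorm R) S b := by
  classical
  simp only [groupRingWeightedNorm_discrete]
  rw [← Finset.sum_union_inter]
  refine le_add_right (Finset.sum_le_sum_of_subset ?_)
  rw [MonoidAlgebra.coeff_add]
  exact Finsupp.support_add

lemma groupRingWeightedNorm_smul_le (r : R) (a : R[G]) :
    groupRingWeightedNorm (discreteNorm R) S (r • a) ≤
      groupRingWeightedNorm (discreteNorm R) S a := by
  simp only [groupRingWeightedNorm_discrete]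
  exact Finset.sum_le_sum_of_subset (Finsupp.support_smul (b := r) (g := a.coeff))

/-- Translation moves the support, and the weights satisfy `1 + ℓ(g x) ≤ (1 + ℓ(g)) (1 + ℓ(x))`. -/
lemma groupRingWeightedNorm_single_mul_le (hS : Subgroup.closure (S : Set G) = ⊤) (g : G)
    (a : R[G]) :
    groupRingWeightedNorm (discreteNorm R) S (MonoidAlgebra.single g 1 * a) ≤
      (1 + wordLength S g) * groupRingWeightedNorm (discreteNorm R) S a := by
  classical
  simp only [groupRingWeightedNorm_discrete]
  have hsub : (MonoidAlgebra.single g 1 * a).coeff.support ⊆ a.coeff.support.image (g * ·) := by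
    intro x hx
    rw [Finsupp.mem_support_iff, MonoidAlgebra.coeff_single_mul_eq_mul_coeff (g⁻¹ * x)
      (fun y _ => by rw [eq_inv_mul_iff_mul_eq]), one_mul, ← Finsupp.mem_support_iff] at hx
    exact Finset.mem_image.2 ⟨_, hx, mul_inv_cancel_left g x⟩
  refine (Finset.sum_le_sum_of_subset hsub).trans ?_
  rw [Finset.sum_image (mul_right_injective g).injOn, Finset.mul_sum]
  refine Finset.sum_le_sum fun x _ => ?_
  have h : (wordLength S (g * x) : ℝ≥0) ≤ wordLength S g + wordLength S x := by
    exact_mod_cast wordLength_mul_le hS g x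
  calc (1 + wordLength S (g * x) : ℝ≥0)
      ≤ 1 + (wordLength S g + wordLength S x) + wordLength S g * wordLength S x :=
        le_add_right (by gcongr)
    _ = (1 + wordLength S g) * (1 + wordLength S x) := by ring

variable {M : Type*} [AddCommGroup M] [Module R[G] M] {k : ℕ} (B : Module.Basis (Fin k) R[G] M)

lemma weightedNorm_zero : weightedNorm (discreteNorm R) S B 0 = 0 := by
  simp [weightedNorm, groupRingWeightedNorm]

lemma weightedNorm_add_le (x y : M) :
    weightedNorm (discreteNorm R) S B (x + y) ≤
      weightedNorm (discreteNorm R) S B x + weightedNorm (discreteNorm R) S B y := by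
  simp only [weightedNorm, map_add, Finsupp.add_apply]
  rw [← Finset.sum_add_distrib]
  exact Finset.sum_le_sum fun b _ => groupRingWeightedNorm_add_le _ _

lemma weightedNorm_sum_le {ι : Type*} (s : Finset ι) (x : ι → M) :
    weightedNorm (discreteNorm R) S B (∑ i ∈ s, x i) ≤
      ∑ i ∈ s, weightedNorm (discreteNorm R) S B (x i) :=
  Finset.le_sum_of_subadditive _ (weightedNorm_zero B).le (weightedNorm_add_le B) s x

variable [Module R M] [IsScalarTower R R[G] M]
  {N : Type*} [AddCommGroup N] [Module R N] [Module R[H] N] [IsScalarTower R R[H] N]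
  {k' : ℕ} (B' : Module.Basis (Fin k') R[H] N)

lemma weightedNorm_smul_le (r : R) (x : M) :
    weightedNorm (discreteNorm R) S B (r • x) ≤ weightedNorm (discreteNorm R) S B x := by
  refine Finset.sum_le_sum fun b _ => ?_
  have : B.repr (r • x) = r • B.repr x := LinearMap.map_smul_of_tower B.repr.toLinearMap r x
  rw [this]
  exact groupRingWeightedNorm_smul_le _ _

lemma weightedNorm_groupAct_le (hS : Subgroup.closure (S : Set G) = ⊤) (g : G) (x : M) :
    weightedNorm (discreteNorm R) S B (groupAct R g x) ≤
      (1 + wordLength S g) * weightedNorm (discreteNorm R) S B x := by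
  rw [weightedNorm, weightedNorm, Finset.mul_sum]
  refine Finset.sum_le_sum fun b _ => ?_
  rw [groupAct_apply, map_smul, Finsupp.smul_apply, smul_eq_mul]
  exact groupRingWeightedNorm_single_mul_le hS _ _

lemma sum_smul_groupAct_basis (x : M) :
    ∑ b, ∑ γ ∈ (B.repr x b).coeff.support,
      (B.repr x b).coeff γ • groupAct R γ (B b) = x := by
  conv_rhs => rw [← B.sum_repr x]
  refine Finset.sum_congr rfl fun b _ => ?_
  conv_rhs => rw [← MonoidAlgebra.sum_coeff_single (B.repr x b), Finsupp.sum, Finset.sum_smul]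
  simp only [single_smul_eq]

/-- The weighted norm of an image is at most the sum of the norms of the images of the basis
elements that occur. -/
lemma weightedNorm_map_le_sum (u : M →ₗ[R] N) (x : M) :
    weightedNorm (discreteNorm R) T B' (u x) ≤
      ∑ b, ∑ γ ∈ (B.repr x b).coeff.support,
        weightedNorm (discreteNorm R) T B' (u (groupAct R γ (B b))) := by
  conv_lhs => rw [← sum_smul_groupAct_basis B x, map_sum]
  refine (weightedNorm_sum_le B' _ _).trans (Finset.sum_le_sum fun b _ => ?_)
  rw [map_sum]
  refine (weightedNorm_sum_le B' _ _).trans (Finset.sum_le_sum fun γ _ => ?_)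
  rw [map_smul]
  exact weightedNorm_smul_le B' _ _

/-- Scalars do not increase the discrete norm, so any linear combination of generators has norm at
most the sum of their norms. -/
lemma exists_weightedNorm_le_of_fg {W : Submodule R N} (hW : W.FG) :
    ∃ C : ℝ≥0, ∀ w ∈ W, weightedNorm (discreteNorm R) T B' w ≤ C := by
  obtain ⟨s, rfl⟩ := hW
  refine ⟨∑ x ∈ s, weightedNorm (discreteNorm R) T B' x, fun w hw => ?_⟩
  obtain ⟨a, -, rfl⟩ := Submodule.mem_span_finset.1 hw
  exact (weightedNorm_sum_le B' _ _).trans (Finset.sum_le_sum fun x _ => weightedNorm_smul_le B' _ _)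

/-- Controlled maps over maps of linear growth are bounded for the weighted norms. -/
lemma IsControlled.exists_weightedNorm_le (hT : Subgroup.closure (T : Set H) = ⊤)
    {f : G → H} (hf : HasLinearGrowth S T f) {u : M →ₗ[R] N} (hu : IsControlled f u) :
    ∃ C : ℝ≥0, ∀ x, weightedNorm (discreteNorm R) T B' (u x) ≤
      C * weightedNorm (discreteNorm R) S B x := by
  obtain ⟨K, hK⟩ := hf
  have (b : Fin k) : ∃ C : ℝ≥0, ∀ γ, weightedNorm (discreteNorm R) T B' (u (groupAct R γ (B b))) ≤
      C * (1 + wordLength S γ) := by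
    obtain ⟨W, hW, hbW⟩ := hu (B b)
    obtain ⟨C, hC⟩ := exists_weightedNorm_le_of_fg (T := T) B' hW
    -- `u(γ b)` is the translate by `f(γ)` of an element of `W`: `C` bounds `W`, and the translation
    -- costs `1 + ℓ(f γ) ≤ K (1 + ℓ(γ))`.
    refine ⟨K * C, fun γ => ?_⟩
    have h := weightedNorm_groupAct_le B' hT (f γ) (groupAct R (f γ)⁻¹ (u (groupAct R γ (B b))))
    rw [groupAct_groupAct_inv] at h
    calc _ ≤ _ := h
      _ ≤ (K * (1 + wordLength S γ)) * C := mul_le_mul' (hK γ) (hC _ (hbW γ))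
      _ = _ := by ring
  choose C hC using this
  refine ⟨∑ b, C b, fun x => (weightedNorm_map_le_sum B B' u x).trans ?_⟩
  rw [weightedNorm, Finset.mul_sum]
  refine Finset.sum_le_sum fun b _ => ?_
  rw [groupRingWeightedNorm_discrete, Finset.mul_sum]
  refine Finset.sum_le_sum fun γ _ => (hC b γ).trans ?_
  gcongr
  exact Finset.single_le_sum (f := C) (fun _ _ => zero_le) (Finset.mem_univ b)

/-- An `R`-linear map is bounded on sets that are bounded for the weighted norm. -/
lemma exists_weightedNorm_map_le (hS : Subgroup.closure (S : Set G) = ⊤) (u : M →ₗ[R] N)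
    (l : ℝ≥0) : ∃ C : ℝ≥0, ∀ x, weightedNorm (discreteNorm R) S B x ≤ l →
      weightedNorm (discreteNorm R) T B' (u x) ≤ C := by
  -- Each `γ` in the support contributes at least `1 + ℓ(γ)` to the norm, hence lies in this finite
  -- ball.
  let E : Finset G := (finite_wordLength_le hS ⌊l⌋₊).toFinset
  refine ⟨∑ b, ∑ γ ∈ E, weightedNorm (discreteNorm R) T B' (u (groupAct R γ (B b))),
    fun x hx => (weightedNorm_map_le_sum B B' u x).trans ?_⟩
  refine Finset.sum_le_sum fun b _ => Finset.sum_le_sum_of_subset fun γ hγ => ?_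
  rw [Set.Finite.mem_toFinset]
  refine Nat.le_floor (le_trans ?_ hx)
  calc (wordLength S γ : ℝ≥0) ≤ 1 + wordLength S γ := le_add_self
    _ ≤ groupRingWeightedNorm (discreteNorm R) S (B.repr x b) := by
      rw [groupRingWeightedNorm_discrete]
      exact Finset.single_le_sum (f := fun γ => (1 + wordLength S γ : ℝ≥0))
        (fun _ _ => zero_le) hγ
    _ ≤ weightedNorm (discreteNorm R) S B x :=
      Finset.single_le_sum (f := fun b => groupRingWeightedNorm (discreteNorm R) S (B.repr x b))
        (fun _ _ => zero_le) (Finset.mem_univ b)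

end Norm

/-! ### Filling functions -/

namespace AdmissibleResolution

variable {R : Type*} [Ring R] {G : Type*} [Group G] {S : Finset G} {H : Type*} [Group H]
  {T : Finset H} {n : ℕ}

lemma weightedFillingVolume_le (P : AdmissibleResolution R G n) (b : P.X (n + 1)) :
    P.weightedFillingVolume (discreteNorm R) S (P.d n b) ≤
      weightedNorm (discreteNorm R) S P.basis' b :=
  iInf₂_le_of_le b rfl le_rfl

lemma weightedFillingVolume_le_fillingFunction (P : AdmissibleResolution R G n) {c : P.X n}
    (hc : P.IsCycle n c) {l : ℝ≥0} (hl : weightedNorm (discreteNorm R) S P.basis c ≤ l) :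
    P.weightedFillingVolume (discreteNorm R) S c ≤ P.weightedDiscreteFillingFunction S l :=
  le_iSup₂_of_le c hc (le_iSup_of_le hl le_rfl)

/-- The weighted discrete filling function takes finite values. -/
theorem weightedDiscreteFillingFunction_lt_top (hS : Subgroup.closure (S : Set G) = ⊤)
    (P : AdmissibleResolution R G n) (l : ℝ≥0) : P.weightedDiscreteFillingFunction S l < ⊤ := by
  obtain ⟨s, hs⟩ := P.exists_contraction n
  obtain ⟨C, hC⟩ := exists_weightedNorm_map_le (T := S) P.basis P.basis' hS s l
  refine lt_of_le_of_lt (iSup₂_le fun c hc => iSup_le fun hl => ?_) (ENNReal.coe_lt_top (r := C))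
  have := P.weightedFillingVolume_le (S := S) (s c)
  rw [hs c hc] at this
  exact this.trans (by exact_mod_cast hC c hl)

/-- A coarse equivalence bounds the filling function of the target by that of the source. -/
theorem fillingLE_of_coarse_inverse (hS : Subgroup.closure (S : Set G) = ⊤)
    (hT : Subgroup.closure (T : Set H) = ⊤) (P : AdmissibleResolution R G n)
    (Q : AdmissibleResolution R H n) {f : G → H} {g : H → G} (hf : IsCoarseLipschitz S T f)
    (hg : IsCoarseLipschitz T S g) (hfg : AreClose id (f ∘ g)) :
    FillingLE (Q.weightedDiscreteFillingFunction T) (P.weightedDiscreteFillingFunction S) := by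
  obtain ⟨φ, ψ, h, hφ, hψ, hh, hφc, hψc, hd⟩ :=
    P.toTrivialResolution.exists_controlled_homotopyEquiv Q.toTrivialResolution
      (hf.isBornologous hT) (hg.isBornologous hS) hfg n
  obtain ⟨φ', hφ', hφd⟩ := TrivialResolution.exists_controlled_lift_d (hf.isBornologous hT)
    (hφ.comp (isControlled_id (P.d n))) fun x => hφc _ (TrivialResolution.isCycle_d x)
  simp only [LinearMap.comp_apply, LinearMap.restrictScalars_apply] at hφd
  obtain ⟨A, hA⟩ := hψ.exists_weightedNorm_le Q.basis P.basis hS (hg.hasLinearGrowth hS)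
  obtain ⟨B, hB⟩ := hφ'.exists_weightedNorm_le P.basis' Q.basis' hT (hf.hasLinearGrowth hT)
  obtain ⟨C, hC⟩ := hh.exists_weightedNorm_le Q.basis Q.basis' hT (hasLinearGrowth_id (S := T))
  -- The first constant dominates the bounds of `ψ`, `φ'` and `h`. The `B` in the second pays for a
  -- filling that is optimal only up to `1`; the summands `1` ensure positivity.
  refine ⟨A + B + C + 1, B + 1, by positivity, by positivity, fun v =>
    iSup₂_le fun c hc => iSup_le fun hv => ?_⟩
  have hψv : weightedNorm (discreteNorm R) S P.basis (ψ c) ≤ (A + B + C + 1) * v + (B + 1) :=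
    calc _ ≤ A * v := (hA c).trans (by gcongr)
      _ ≤ (A + (B + C + 1)) * v + (B + 1) := le_add_right (by gcongr; exact le_self_add)
      _ = _ := by ring
  set F := P.weightedDiscreteFillingFunction S ((A + B + C + 1) * v + (B + 1)) with hF
  -- The infimum need not be known to be attained, so a filling of norm below `F + 1` is chosen; the
  -- strict inequality needs `F` finite.
  have hFtop : F ≠ ⊤ := (P.weightedDiscreteFillingFunction_lt_top hS _).ne
  have hlt : P.weightedFillingVolume (discreteNorm R) S (ψ c) < F + 1 :=
    (P.weightedFillingVolume_le_fillingFunction (hψc c hc) hψv).trans_lt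
      (ENNReal.lt_add_right hFtop one_ne_zero)
  simp only [weightedFillingVolume, iInf_lt_iff] at hlt
  obtain ⟨b, hb, hbF⟩ := hlt
  -- `∂ φ' b = φ ∂ b = φ ψ c` and `∂ h c = c - φ ψ c`.
  have hfill : Q.d n (φ' b + h c) = c := by
    rw [map_add, hφd, hb, hd c hc, add_sub_cancel]
  have hvol := Q.weightedFillingVolume_le (S := T) (φ' b + h c)
  rw [hfill] at hvol
  have hnorm : weightedNorm (discreteNorm R) T Q.basis' (φ' b + h c) ≤
      B * weightedNorm (discreteNorm R) S P.basis' b + C * v :=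
    (weightedNorm_add_le _ _ _).trans (add_le_add (hB b) ((hC c).trans (by gcongr)))
  calc _ ≤ _ := hvol
    _ ≤ ((B * weightedNorm (discreteNorm R) S P.basis' b + C * v : ℝ≥0) : ℝ≥0∞) := by
      exact_mod_cast hnorm
    _ = B * (weightedNorm (discreteNorm R) S P.basis' b : ℝ≥0∞) + C * v := by push_cast; rfl
    _ ≤ B * (F + 1) + C * v := by gcongr
    _ ≤ (A + B + C + 1) * F + (A + B + C + 1) * v + (B + 1) := by
      rw [mul_add, mul_one, add_right_comm]
      gcongr
      · exact le_add_right (le_add_right le_add_self)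
      · exact le_add_right le_add_self
      · exact le_self_add
    _ = _ := by push_cast; rfl

end AdmissibleResolution

end

theorem mainTheorem4 {R : Type u} [Ring R] [Nontrivial R]
    {G : Type v₁} [Group G] {H : Type v₂} [Group H] (n : ℕ)
    (hG : IsOfTypeFP R G (n + 1)) (hH : IsOfTypeFP R H (n + 1))
    (S : Finset G) (hS : Subgroup.closure (S : Set G) = ⊤)
    (T : Finset H) (hT : Subgroup.closure (T : Set H) = ⊤)
    (hGH : QuasiIsometric S T)
    (P : AdmissibleResolution.{u, v₁, w₁} R G n) (Q : AdmissibleResolution.{u, v₂, w₂} R H n) :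
    (∀ l, P.weightedDiscreteFillingFunction S l < ⊤) ∧
    (∀ l, Q.weightedDiscreteFillingFunction T l < ⊤) ∧
    FillingEquiv (P.weightedDiscreteFillingFunction S) (Q.weightedDiscreteFillingFunction T) := by
  obtain ⟨f, g, hf, hg, hfg, hgf⟩ := hGH.exists_coarse_inverse hS hT
  exact ⟨P.weightedDiscreteFillingFunction_lt_top hS, Q.weightedDiscreteFillingFunction_lt_top hT,
    Q.fillingLE_of_coarse_inverse hT hS P hg hf hgf,
    P.fillingLE_of_coarse_inverse hS hT Q hf hg hfg⟩
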